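/- Let $G$ be a finite weighted undirected graph without loops on $n$ vertices, with edge weights $w_{uv}=w_{vu}>0$ (and $w_{uv}=0$ if $uv$ is not an edge), such that every vertex has positive degree $d(u)=\sum_v w_{uv}$. Let $A=(w_{uv})$, $D=\mathrm{diag}(d(u))$, and let $\lambda_1\le\cdots\le\lambda_n$ be the eigenvalues, with multiplicity, of the normalized Laplacian $L=D^{-1/2}(D-A)D^{-1/2}$. For disjoint vertex sets $S,S'$, not both empty, the bipartite conductance is $$\tilde\phi_G(S,S')=\frac{\sum_{u\in S\cup S',\,v\notin S\cup S'}w_{uv}+\sum_{u,v\in S}w_{uv}+\sum_{u,v\in S'}w_{uv}}{\sum_{u\in S\cup S'}d(u)},$$ where the sums run over ordered pairs (so an edge inside $S$ or inside $S'$ counts twice). Let $1\le k\le n$. (A) There are pairwise disjoint vertex sets $S_1,S_1',\dots,S_k,S_k'$, with $S_i\cup S_i'\neq\emptyset$ for every $i$, such that for each $1\le i\le k$ $$\tilde\phi_G(S_i,S_i')\le\frac{2(8k+1)(4k-1)}{k+1-i}\sqrt{\frac{\sum_{j=1}^{k}(2-\lambda_{n+1-j})}{k}}.$$ (B) For every natural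 number $r\le k/2$ there are pairwise disjoint vertex sets $S_1,S_1',\dots,S_r,S_r'$, with $S_i\cup S_i'\neq\emptyset$ for every $i$, such that for each $1\le i\le r$ $$\tilde\phi_G(S_i,S_i')\le\frac{10^{1.5}\left(1280\sqrt{3\ln(200k^2)}+4\right)k}{9\left(\frac k2+1-i\right)}\sqrt{\frac{\sum_{j=1}^{k}(2-\lambda_{n+1-j})}{k}}.$$ -/

import Mathlib

/-- A finite weighted undirected (simple) graph on the vertex set `V`, given by its weighted
adjacency matrix: `weight u v` is the (positive) weight of the edge `uv`, and it is `0` exactly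
when `uv` is not an edge. There are no loops. -/
structure WeightedGraph (V : Type*) where
  weight : V → V → ℝ
  symm : ∀ u v, weight u v = weight v u
  nonneg : ∀ u v, 0 ≤ weight u v
  loopless : ∀ v, weight v v = 0

namespace WeightedGraph

variable {V : Type*} [Fintype V] [DecidableEq V] (G : WeightedGraph V)

/-- The weighted degree of a vertex. -/
def degree (v : V) : ℝ := ∑ u, G.weight v u

/-- The weighted adjacency matrix `A`. -/
def adjMatrix : Matrix V V ℝ := Matrix.of G.weight

/-- The degree matrix `D`. -/
def degMatrix : Matrix V V ℝ := Matrix.diagonal G.degree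

/-- The matrix `D^{-1/2}`. -/
noncomputable def invSqrtDegMatrix : Matrix V V ℝ :=
  Matrix.diagonal fun v => (√(G.degree v))⁻¹

/-- The normalized Laplacian `L = D^{-1/2} (D - A) D^{-1/2}`. -/
noncomputable def normLaplacian : Matrix V V ℝ :=
  G.invSqrtDegMatrix * (G.degMatrix - G.adjMatrix) * G.invSqrtDegMatrix

theorem normLaplacian_isHermitian : G.normLaplacian.IsHermitian := by
  have hA : G.adjMatrix.IsHermitian := by
    ext u v
    simp [adjMatrix, G.symm u v]
  have hD : G.degMatrix.IsHermitian := by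
    simp [degMatrix, Matrix.IsHermitian]
  have hI : G.invSqrtDegMatrix.conjTranspose = G.invSqrtDegMatrix := by
    simp [invSqrtDegMatrix]
  have h := Matrix.isHermitian_mul_mul_conjTranspose G.invSqrtDegMatrix (hD.sub hA)
  rwa [hI] at h

/-- The eigenvalues of the normalized Laplacian, with multiplicity, in nondecreasing order
(Mathlib's `eigenvalues₀` are in nonincreasing order). With `n` vertices and 0-based indices,
`G.eigenvalue j` is `λ_{j+1}` in `λ_1 ≤ ⋯ ≤ λ_n`. -/
noncomputable def eigenvalue (j : Fin (Fintype.card V)) : ℝ :=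
  G.normLaplacian_isHermitian.eigenvalues₀ j.rev

theorem eigenvalue_monotone : Monotone G.eigenvalue := fun _ _ h =>
  G.normLaplacian_isHermitian.eigenvalues₀_antitone (Fin.rev_le_rev.mpr h)

/-- The total weight of a set of stubs. The stub at `u` of the edge `uv` is the ordered pair
`(u, v)`; it carries the weight of the edge (and pairs that are not edges have weight `0`).
An edge, seen as its two stubs, contributes twice its weight. -/
def stubWeight (T : Finset (V × V)) : ℝ := ∑ s ∈ T, G.weight s.1 s.2

/-- `C(S)`: the stubs incident with `S`. -/
def coloredStubs (S : Finset V) : Finset (V × V) :=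
  Finset.univ.filter fun s => s.1 ∈ S

/-- `B(S)`: the stubs incident with `S` whose opposite stub is not incident with `S`. -/
def badStubs (S : Finset V) : Finset (V × V) :=
  Finset.univ.filter fun s => s.1 ∈ S ∧ s.2 ∉ S

/-- `B'(S, S')`: the edges contained in `S` or contained in `S'`, each given as its two stubs. -/
def innerStubs (S S' : Finset V) : Finset (V × V) :=
  Finset.univ.filter fun s => (s.1 ∈ S ∧ s.2 ∈ S) ∨ (s.1 ∈ S' ∧ s.2 ∈ S')

/-- The bipartite conductance of the pair `S, S'`:
`‖B(S ∪ S') ∪ B'(S, S')‖ / ‖C(S ∪ S')‖`. -/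
noncomputable def bipartiteConductance (S S' : Finset V) : ℝ :=
  G.stubWeight (badStubs (S ∪ S') ∪ innerStubs S S') / G.stubWeight (coloredStubs (S ∪ S'))

/-- The average of `2 - λ_{n+1-i}` over `1 ≤ i ≤ k`, i.e. over the `k` largest eigenvalues. -/
noncomputable def avgTopGap (k : ℕ) (hk : k ≤ Fintype.card V) : ℝ :=
  (∑ i : Fin k, (2 - G.eigenvalue (Fin.castLE hk i).rev)) / k

end WeightedGraph

/-- `(S_i, S_i')`, `i < r`, are `r` bipartite communities on pairwise disjoint vertex sets: all the
`2r` sets are pairwise disjoint, and no pair consists of two empty sets. -/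
structure IsDisjointCommunities {V : Type*} [DecidableEq V] {r : ℕ}
    (S S' : Fin r → Finset V) : Prop where
  nonempty : ∀ i, (S i ∪ S' i).Nonempty
  disjoint_pair : ∀ i, Disjoint (S i) (S' i)
  disjoint_of_ne : ∀ i j, i ≠ j → Disjoint (S i ∪ S' i) (S j ∪ S' j)

/-! The eigenvectors of the `k` largest eigenvalues, rescaled by `D^{-1/2}`, embed the vertices in
`ℝ^k` by a map `f` with `∑ d(v) f(v) f(v)ᵀ = I` and `∑ w_{uv} ‖f u + f v‖² = 2 ∑ (2 - λ)` over those
eigenvalues. A small right side means that edges join nearly antipodal vectors. So directions are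
clustered up to sign, and the sign splits each cluster into two sides.

Give `v` the mass `μ v = d(v) ‖f v‖²`; the total is `k`. Isotropy makes `∑ μ v ⟨x, x_v⟩² = 1` for
every unit vector `x`, where `x_v` is the direction of `f v`. Hence directions with squared inner
product at least `s` with a given one carry mass at most `1/s`, and a partition that rarely puts
dissimilar directions together has classes of mass little above `1/s`. These are merged greedily
into `r` groups of mass at least `1/2`.

The partition is a derandomized correlated sampling (`exists_signed_partition`). Each direction gets
a probability distribution on words of `m` signed basis vectors, from squared coordinates of a
tensor power. The overlap decays exponentially in `m` for far lines, while nearly antipodal vectors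
lose only `√m ‖x + y‖` (`sum_min_tensorWeight_le`, `one_sub_sum_opposite_le`).

A Cheeger sweep of `‖f‖²` on each group gives the pairs of sets (`exists_bipartiteConductance_le`).
The sum of all numerators is controlled by Cauchy–Schwarz, and sorting the ratios gives the
denominator `r - i`. Parts (A) and (B) differ only in the choice of `s` and `m`. -/

/-! ### Superlevel sets, carving, greedy grouping and sorting. -/

open Finset in
/-- If a combination of minima and maxima of the values of a nonnegative function `q` is
nonpositive, then so is the same combination of indicators for some nonempty superlevel set. -/
theorem exists_superlevel_nonpos {V : Type*} [DecidableEq V] (R : Finset V)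
    (α β : V → V → ℝ) (q : V → ℝ) (hq : ∀ v, 0 ≤ q v) (hne : ∃ v ∈ R, 0 < q v)
    (hQ : ∑ u ∈ R, ∑ v ∈ R, (α u v * min (q u) (q v) + β u v * max (q u) (q v)) ≤ 0) :
    ∃ t : ℝ, 0 < t ∧ (∃ v ∈ R, t ≤ q v) ∧
      ∑ u ∈ R, ∑ v ∈ R, (α u v * (if t ≤ q u ∧ t ≤ q v then 1 else 0) +
        β u v * (if t ≤ q u ∨ t ≤ q v then 1 else 0)) ≤ 0 := by
  induction hn : #{v ∈ R | 0 < q v} using Nat.strong_induction_on generalizing q with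
  | _ n ih =>
  obtain ⟨v₀, hv₀, hmin⟩ := exists_min_image {v ∈ R | 0 < q v} q
    (by obtain ⟨v, hv, h⟩ := hne; exact ⟨v, by simp [hv, h]⟩)
  rw [mem_filter] at hv₀
  set c := q v₀ with hc
  have hle : ∀ v ∈ R, c ≤ q v ∨ q v = 0 := fun v hv => by
    rcases (hq v).eq_or_lt with h | h
    · exact Or.inr h.symm
    · exact Or.inl (hmin v (by simp [hv, h]))
  by_cases hG : ∑ u ∈ R, ∑ v ∈ R, (α u v * (if c ≤ q u ∧ c ≤ q v then 1 else 0) +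
        β u v * (if c ≤ q u ∨ c ≤ q v then 1 else 0)) ≤ 0
  · exact ⟨c, hv₀.2, ⟨v₀, hv₀.1, le_rfl⟩, hG⟩
  push Not at hG
  -- Peel off the lowest layer: the functional of `q` is that of `q'` plus `c` times the indicator
  -- functional at level `c`. If the latter is positive, the former is negative, and `q'` has fewer
  -- positive values.
  set q' : V → ℝ := fun v => max (q v - c) 0 with hq'
  have key : ∑ u ∈ R, ∑ v ∈ R, (α u v * min (q u) (q v) + β u v * max (q u) (q v)) =
      ∑ u ∈ R, ∑ v ∈ R, (α u v * min (q' u) (q' v) + β u v * max (q' u) (q' v)) +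
      c * ∑ u ∈ R, ∑ v ∈ R, (α u v * (if c ≤ q u ∧ c ≤ q v then 1 else 0) +
        β u v * (if c ≤ q u ∨ c ≤ q v then 1 else 0)) := by
    rw [mul_sum, ← sum_add_distrib]
    refine sum_congr rfl fun u hu => ?_
    rw [mul_sum, ← sum_add_distrib]
    refine sum_congr rfl fun v hv => ?_
    have h1 : min (q u) (q v) = min (q' u) (q' v) + c * (if c ≤ q u ∧ c ≤ q v then 1 else 0) := by
      have := hv₀.2
      rcases hle u hu with h | h <;> rcases hle v hv with h' | h' <;>
        simp [hq', h, h', this.le, this.not_ge, min_sub_sub_right, hq]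
    have h2 : max (q u) (q v) = max (q' u) (q' v) + c * (if c ≤ q u ∨ c ≤ q v then 1 else 0) := by
      have := hv₀.2
      rcases hle u hu with h | h <;> rcases hle v hv with h' | h' <;>
        simp [hq', h, h', this.le, this.not_ge, max_sub_sub_right, hq]
    rw [h1, h2]; ring
  have hneg : ∑ u ∈ R, ∑ v ∈ R, (α u v * min (q' u) (q' v) + β u v * max (q' u) (q' v)) < 0 := by
    have := mul_pos hv₀.2 hG
    linarith
  have hne' : ∃ v ∈ R, 0 < q' v := by
    by_contra! h
    have h0 : ∀ v ∈ R, q' v = 0 := fun v hv => le_antisymm (h v hv) (le_max_right _ _)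
    refine hneg.ne (sum_eq_zero fun u hu => sum_eq_zero fun v hv => ?_)
    simp [h0 u hu, h0 v hv]
  have hcard : #{v ∈ R | 0 < q' v} < n := by
    rw [← hn]
    refine card_lt_card ⟨fun v hv => ?_, fun h => ?_⟩
    · simp only [mem_filter, hq', lt_max_iff, lt_irrefl, or_false] at hv ⊢
      exact ⟨hv.1, by linarith [hv₀.2]⟩
    · have := h (mem_filter.2 hv₀)
      simp [hq', ← hc] at this
  obtain ⟨t, ht, hv, h⟩ := ih _ hcard q' (fun v => le_max_right _ _) hne' hneg.le rfl
  have hiff : ∀ v, t ≤ q' v ↔ t + c ≤ q v := fun v => by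
    simp only [hq', le_max_iff, ht.not_ge, or_false, le_sub_iff_add_le]
  simp only [hiff] at hv h
  exact ⟨t + c, by linarith [hv₀.2], hv, h⟩

open Finset in
/-- Carving a finite set along superlevel sets of the functions `q l`. -/
theorem exists_signed_partition {V L : Type*} [Fintype V] [DecidableEq V] [Fintype L]
    (q : L → V → ℝ) (σ : L → V → Bool) (hq : ∀ l v, 0 ≤ q l v) (hq1 : ∀ v, ∑ l, q l v = 1)
    (a b : V → V → ℝ) (ha : ∀ u v, 0 ≤ a u v) (hb : ∀ u v, 0 ≤ b u v) :
    ∃ (c : V → V) (τ : V → Bool),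
      ∑ u, ∑ v, (a u v * (if c u = c v ∧ τ u ≠ τ v then 0 else 1) +
        b u v * (if c u = c v then 1 else 0)) ≤
      ∑ u, ∑ v, (2 * a u v * (1 - ∑ l, if σ l u ≠ σ l v then min (q l u) (q l v) else 0) +
        b u v * ∑ l, min (q l u) (q l v)) := by
  set good : V → V → ℝ := fun u v => ∑ l, if σ l u ≠ σ l v then min (q l u) (q l v) else 0
  set tog : V → V → ℝ := fun u v => ∑ l, min (q l u) (q l v)
  -- `B u v` is the budget of a pair, spent when a carved set first contains one of its points. For
  -- a random label and threshold, the events that both points are caught, both on opposite sides,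
  -- or at least one are in proportion `tog : good : 2 - tog`.
  set B : V → V → ℝ := fun u v => 2 * a u v * (1 - good u v) + b u v * tog u v with hB
  have hgt : ∀ u v, good u v ≤ tog u v := fun u v => sum_le_sum fun l _ => by
    split_ifs
    · rfl
    · exact le_min (hq _ _) (hq _ _)
  have htog0 : ∀ u v, 0 ≤ tog u v := fun u v => sum_nonneg fun l _ => le_min (hq _ _) (hq _ _)
  have htog1 : ∀ u v, tog u v ≤ 1 := fun u v => by
    rw [← hq1 u]
    exact sum_le_sum fun l _ => min_le_left _ _
  have hmax : ∀ u v, ∑ l, max (q l u) (q l v) = 2 - tog u v := fun u v => by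
    rw [eq_sub_iff_add_eq, ← sum_add_distrib]
    simp only [max_add_min]
    rw [sum_add_distrib, hq1, hq1]; norm_num
  -- A class is named by one of its points. Requiring `c` to preserve `R` keeps the name of a newly
  -- carved class distinct from the names used in the remainder.
  suffices H : ∀ R : Finset V, ∃ (c : V → V) (τ : V → Bool), (∀ u ∈ R, c u ∈ R) ∧
      ∑ u ∈ R, ∑ v ∈ R, (a u v * (if c u = c v ∧ τ u ≠ τ v then 0 else 1) +
        b u v * (if c u = c v then 1 else 0)) ≤ ∑ u ∈ R, ∑ v ∈ R, B u v by
    obtain ⟨c, τ, -, h⟩ := H univ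
    exact ⟨c, τ, h⟩
  intro R
  induction R using Finset.strongInduction with
  | H R ih =>
  rcases R.eq_empty_or_nonempty with rfl | ⟨w, hw⟩
  · exact ⟨id, fun _ => true, by simp⟩
  -- Summed over labels, cost minus budget is nonpositive pair by pair, so some label with positive
  -- weight on `R` does not exceed the budget.
  obtain ⟨l, hl, hlQ⟩ : ∃ l, (∃ v ∈ R, 0 < q l v) ∧ ∑ u ∈ R, ∑ v ∈ R,
      ((b u v - if σ l u ≠ σ l v then a u v else 0) * min (q l u) (q l v) +
        (a u v - B u v) * max (q l u) (q l v)) ≤ 0 := by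
    by_contra! hcon
    have htot : ∑ l, ∑ u ∈ R, ∑ v ∈ R,
        ((b u v - if σ l u ≠ σ l v then a u v else 0) * min (q l u) (q l v) +
        (a u v - B u v) * max (q l u) (q l v)) ≤ 0 := by
      rw [sum_comm]
      refine sum_nonpos fun u _ => ?_
      rw [sum_comm]
      refine sum_nonpos fun v _ => ?_
      have hite : ∀ l, (if σ l u ≠ σ l v then a u v else 0) * min (q l u) (q l v) =
          a u v * (if σ l u ≠ σ l v then min (q l u) (q l v) else 0) := fun l => by
        split_ifs <;> simp
      have : ∑ l, ((b u v - if σ l u ≠ σ l v then a u v else 0) * min (q l u) (q l v) +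
          (a u v - B u v) * max (q l u) (q l v)) =
          b u v * tog u v - a u v * good u v + (a u v - B u v) * (2 - tog u v) := by
        rw [← hmax, sum_add_distrib, ← mul_sum]
        simp only [sub_mul (b u v), hite, sum_sub_distrib, ← mul_sum, tog, good]
      rw [this, hB]
      have h1 := hgt u v
      have h2 := htog0 u v
      have h3 := htog1 u v
      have e1 : 0 ≤ b u v * (tog u v * (1 - tog u v)) :=
        mul_nonneg (hb _ _) (mul_nonneg h2 (by linarith))
      have e2 : 0 ≤ a u v * ((1 - good u v) * (2 - tog u v) - (1 - tog u v)) := by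
        refine mul_nonneg (ha _ _) ?_
        nlinarith
      have e3 : 0 ≤ a u v * ((1 - good u v) * (1 - tog u v)) :=
        mul_nonneg (ha _ _) (mul_nonneg (by linarith) (by linarith))
      linarith
    obtain ⟨l, -, hl⟩ : ∃ l ∈ univ, 0 < q l w :=
      exists_lt_of_sum_lt (by simp [hq1])
    refine htot.not_gt (sum_pos' (fun l _ => ?_) ⟨l, mem_univ _, hcon l ⟨w, hw, hl⟩⟩)
    by_cases h : ∃ v ∈ R, 0 < q l v
    · exact (hcon l h).le
    · push Not at h
      have h0 : ∀ v ∈ R, q l v = 0 := fun v hv => le_antisymm (h v hv) (hq _ _)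
      refine (sum_eq_zero fun u hu => sum_eq_zero fun v hv => ?_).ge
      simp [h0 u hu, h0 v hv]
  obtain ⟨t, ht, ⟨s, hsR, hst⟩, hG⟩ := exists_superlevel_nonpos R _ _ (q l) (hq l) hl hlQ
  obtain ⟨c, τ, hcR, hc⟩ := ih {v ∈ R | ¬ t ≤ q l v} (filter_ssubset.2 ⟨s, hsR, by simpa using hst⟩)
  have hcR' : ∀ u ∈ R, ¬ t ≤ q l u → c u ∈ R ∧ ¬ t ≤ q l (c u) := fun u hu h => by
    simpa using hcR u (by simpa using ⟨hu, not_le.1 h⟩)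
  refine ⟨fun u => if t ≤ q l u then s else c u, fun u => if t ≤ q l u then σ l u else τ u,
    fun u hu => ?_, ?_⟩
  · dsimp only
    split_ifs with h
    · exact hsR
    · exact (hcR' u hu h).1
  have hconv : ∀ F : V → V → ℝ, ∑ u ∈ {v ∈ R | ¬ t ≤ q l v}, ∑ v ∈ {v ∈ R | ¬ t ≤ q l v}, F u v =
      ∑ u ∈ R, ∑ v ∈ R, if t ≤ q l u ∨ t ≤ q l v then 0 else F u v := fun F => by
    rw [sum_filter]
    refine sum_congr rfl fun u _ => ?_
    rw [sum_filter]
    by_cases h : t ≤ q l u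
    · simp [h]
    · simp only [h, not_false_eq_true, if_true, false_or]
      exact sum_congr rfl fun v _ => by split_ifs <;> rfl
  rw [hconv, hconv] at hc
  rw [← sub_nonpos, ← sum_sub_distrib] at hc ⊢
  refine le_trans (le_of_eq ?_) (add_nonpos hG hc)
  rw [← sum_add_distrib]
  refine sum_congr rfl fun u hu => ?_
  rw [← sum_sub_distrib, ← sum_sub_distrib, ← sum_add_distrib]
  refine sum_congr rfl fun v hv => ?_
  by_cases h : t ≤ q l u <;> by_cases h' : t ≤ q l v
  · by_cases hσ : σ l u = σ l v
    · simp [h, h', hσ]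
      ring
    · simp [h, h', hσ]
  · have : s ≠ c v := fun e => (hcR' v hv h').2 (e ▸ hst)
    simp [h, h', this]
  · have : c u ≠ s := fun e => (hcR' u hu h).2 (e ▸ hst)
    simp [h, h', this]
  · simp [h, h']

open Finset in
/-- Greedy grouping of items into `r` groups of mass at least `1 / 2`. -/
theorem exists_disjoint_groups {ι : Type*} [DecidableEq ι] (m : ι → ℝ)
    {K : ℝ} (hK : 1 ≤ K) (r : ℕ) (T : Finset ι)
    (hT : (r - 1) * K + ∑ i ∈ T, max (m i - K) 0 + 1 / 2 < ∑ i ∈ T, m i) :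
    ∃ P : Fin r → Finset ι, (∀ i, P i ⊆ T) ∧ (∀ i j, i ≠ j → Disjoint (P i) (P j)) ∧
      ∀ i, 1 / 2 ≤ ∑ x ∈ P i, m x := by
  induction r generalizing T with
  | zero => exact ⟨fun i => i.elim0, fun i => i.elim0, fun i => i.elim0, fun i => i.elim0⟩
  | succ r ih =>
  push_cast at hT
  have hT0 : (1 : ℝ) / 2 ≤ ∑ i ∈ T, m i := by
    have h1 : 0 ≤ ∑ i ∈ T, max (m i - K) 0 := sum_nonneg fun i _ => le_max_right _ _
    have h2 : 0 ≤ (r : ℝ) * K := by positivity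
    linarith
  -- A minimal set of mass at least `1/2` is either a single item or has mass below `1/2 + 1/2 ≤ K`,
  -- since both an item and its complement in the set fall short. So it uses up at most `K` plus its
  -- own excess.
  obtain ⟨P, hP, hmin⟩ := exists_min_image {P ∈ T.powerset | 1 / 2 ≤ ∑ i ∈ P, m i} card
    ⟨T, by simpa using hT0⟩
  simp only [mem_filter, mem_powerset] at hP hmin
  have hPK : ∑ i ∈ P, m i ≤ K + ∑ i ∈ P, max (m i - K) 0 := by
    obtain ⟨p, hp⟩ : P.Nonempty := by
      rw [nonempty_iff_ne_empty]
      rintro rfl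
      norm_num at hP
    by_cases h1 : P = {p}
    · simp only [h1, sum_singleton]
      linarith [le_max_left (m p - K) 0]
    · have hlt : ∀ Q ⊂ P, ∑ i ∈ Q, m i < 1 / 2 := fun Q hQ => by
        by_contra! h
        exact (card_lt_card hQ).not_ge (hmin Q ⟨hQ.1.trans hP.1, h⟩)
      have e1 := hlt (P.erase p) (erase_ssubset hp)
      have e2 := hlt {p} ((singleton_subset_iff.2 hp).ssubset_of_ne (Ne.symm h1))
      rw [sum_singleton] at e2
      have e3 := add_sum_erase P m hp
      have e4 : 0 ≤ ∑ i ∈ P, max (m i - K) 0 := sum_nonneg fun i _ => le_max_right _ _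
      linarith
  obtain ⟨Q, hQT, hQd, hQ⟩ := ih (T \ P) (by
    have e1 := sum_sdiff hP.1 (f := m)
    have e2 := sum_sdiff hP.1 (f := fun i => max (m i - K) 0)
    linarith)
  refine ⟨Fin.cons P Q, fun i => ?_, fun i j => ?_, fun i => ?_⟩
  · refine Fin.cases ?_ (fun i => ?_) i
    · exact hP.1
    · simpa using (hQT i).trans sdiff_subset
  · have hd : ∀ i, Disjoint P (Q i) := fun i =>
      disjoint_of_subset_right (hQT i) disjoint_sdiff
    refine Fin.cases ?_ (fun i => ?_) i <;> refine Fin.cases ?_ (fun j => ?_) j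
    · simp
    · simpa using fun _ => hd j
    · simpa using (hd i).symm
    · simpa using hQd i j
  · refine Fin.cases ?_ (fun i => ?_) i
    · simpa using hP.2
    · simpa using hQ i

open Finset in
/-- After sorting, the `i`-th of `r` nonnegative numbers is at most their sum divided by `r - i`. -/
theorem exists_perm_le_sum_div {r : ℕ} (ρ : Fin r → ℝ) (hρ : ∀ i, 0 ≤ ρ i) :
    ∃ e : Equiv.Perm (Fin r), ∀ i, ρ (e i) ≤ (∑ j, ρ j) / ((r : ℝ) - i) := by
  refine ⟨Tuple.sort ρ, fun i => ?_⟩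
  have hi : (0 : ℝ) < r - i := by
    rw [sub_pos]; exact_mod_cast i.2
  rw [le_div_iff₀ hi]
  calc ρ (Tuple.sort ρ i) * (r - i) = ∑ j ∈ Ici i, ρ (Tuple.sort ρ i) := by
        rw [sum_const, Fin.card_Ici, nsmul_eq_mul, Nat.cast_sub i.2.le, mul_comm]
    _ ≤ ∑ j ∈ Ici i, ρ (Tuple.sort ρ j) :=
        sum_le_sum fun j hj => Tuple.monotone_sort ρ (mem_Ici.1 hj)
    _ ≤ ∑ j, ρ (Tuple.sort ρ j) := sum_le_univ_sum_of_nonneg fun j => hρ _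
    _ = ∑ j, ρ j := Equiv.sum_comp (Tuple.sort ρ) ρ

/-! ### Distributions on words of signed basis vectors. -/

open Finset in
/-- The positive part of the coordinate of `x` along a signed standard basis vector. -/
noncomputable def signedPart {k : ℕ} (x : Fin k → ℝ) (e : Fin k × Bool) : ℝ :=
  max (if e.2 then x e.1 else - x e.1) 0

/-- The product of the signed parts of `x` along a sequence of signed basis vectors. -/
noncomputable def signedProd {k m : ℕ} (l : Fin m → Fin k × Bool) (x : Fin k → ℝ) : ℝ :=
  ∏ j, signedPart x (l j)

/-- The weight of a vector, up to sign, on a sequence of signed basis vectors. -/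
noncomputable def tensorWeight {k m : ℕ} (l : Fin m → Fin k × Bool) (x : Fin k → ℝ) : ℝ :=
  (signedProd l x ^ 2 + signedProd l (-x) ^ 2) / 2

/-- The side on which a vector lies with respect to a sequence of signed basis vectors. -/
noncomputable def tensorSide {k m : ℕ} (l : Fin m → Fin k × Bool) (x : Fin k → ℝ) : Bool :=
  decide (0 < signedProd l x)

section

variable {k m : ℕ}

theorem signedPart_nonneg (x : Fin k → ℝ) (e : Fin k × Bool) : 0 ≤ signedPart x e :=
  le_max_right _ _

theorem signedProd_nonneg (l : Fin m → Fin k × Bool) (x : Fin k → ℝ) : 0 ≤ signedProd l x :=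
  Finset.prod_nonneg fun _ _ => signedPart_nonneg _ _

theorem tensorWeight_nonneg (l : Fin m → Fin k × Bool) (x : Fin k → ℝ) : 0 ≤ tensorWeight l x := by
  unfold tensorWeight; positivity

theorem sum_signedProd_mul (x y : Fin k → ℝ) :
    ∑ l : Fin m → Fin k × Bool, signedProd l x * signedProd l y =
      (∑ e, signedPart x e * signedPart y e) ^ m := by
  rw [Fintype.sum_pow]
  simp only [signedProd, Finset.prod_mul_distrib]

theorem signedPart_mul_add (x y : Fin k → ℝ) (i : Fin k) :
    signedPart x (i, true) * signedPart y (i, true) +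
      signedPart x (i, false) * signedPart y (i, false) = (|x i * y i| + x i * y i) / 2 := by
  simp only [signedPart, if_true, Bool.false_eq_true, if_false]
  rcases le_total 0 (x i) with h | h <;> rcases le_total 0 (y i) with h' | h' <;>
    simp [h, h', abs_mul, abs_of_nonneg, abs_of_nonpos]

theorem sum_signedPart_mul (x y : Fin k → ℝ) :
    ∑ e, signedPart x e * signedPart y e = ∑ i, (|x i * y i| + x i * y i) / 2 := by
  rw [Fintype.sum_prod_type]
  exact Finset.sum_congr rfl fun i _ => by
    rw [Fintype.sum_bool, signedPart_mul_add]

theorem sum_signedPart_mul_nonneg (x y : Fin k → ℝ) :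
    0 ≤ ∑ e, signedPart x e * signedPart y e :=
  Finset.sum_nonneg fun _ _ => mul_nonneg (signedPart_nonneg _ _) (signedPart_nonneg _ _)

theorem le_sum_signedPart_mul (x y : Fin k → ℝ) :
    ∑ i, x i * y i ≤ ∑ e, signedPart x e * signedPart y e := by
  rw [sum_signedPart_mul]
  exact Finset.sum_le_sum fun i _ => by linarith [le_abs_self (x i * y i)]

/-- Splitting coordinates into signed parts drops the negative contributions `x i * y i`, and AM–GM
bounds the rest. Even antipodal vectors thus get a nonnegative kernel, whose powers can decay. -/
theorem sum_signedPart_mul_le {x y : Fin k → ℝ} (hx : ∑ i, x i ^ 2 = 1) (hy : ∑ i, y i ^ 2 = 1) :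
    ∑ e, signedPart x e * signedPart y e ≤ (1 + ∑ i, x i * y i) / 2 := by
  rw [sum_signedPart_mul]
  have : (1 + ∑ i, x i * y i) / 2 = ∑ i, ((x i ^ 2 + y i ^ 2) / 2 + x i * y i) / 2 := by
    rw [← Finset.sum_div, Finset.sum_add_distrib, ← Finset.sum_div, Finset.sum_add_distrib, hx, hy]
    norm_num
  rw [this]
  refine Finset.sum_le_sum fun i _ => ?_
  have h : |x i * y i| ≤ (x i ^ 2 + y i ^ 2) / 2 := by
    rw [abs_mul, ← sq_abs (x i), ← sq_abs (y i)]
    nlinarith [sq_nonneg (|x i| - |y i|)]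
  linarith

theorem sum_signedProd_sq {x : Fin k → ℝ} (hx : ∑ i, x i ^ 2 = 1) :
    ∑ l : Fin m → Fin k × Bool, signedProd l x ^ 2 = 1 := by
  simp only [sq (signedProd _ _)]
  rw [sum_signedProd_mul, sum_signedPart_mul]
  have : ∑ i, (|x i * x i| + x i * x i) / 2 = ∑ i, x i ^ 2 :=
    Finset.sum_congr rfl fun i _ => by rw [abs_mul_self]; ring
  rw [this, hx, one_pow]

theorem sum_neg_sq {x : Fin k → ℝ} (hx : ∑ i, x i ^ 2 = 1) : ∑ i, (-x) i ^ 2 = 1 := by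
  simpa using hx

theorem sum_tensorWeight {x : Fin k → ℝ} (hx : ∑ i, x i ^ 2 = 1) :
    ∑ l : Fin m → Fin k × Bool, tensorWeight l x = 1 := by
  simp only [tensorWeight]
  rw [← Finset.sum_div, Finset.sum_add_distrib, sum_signedProd_sq hx,
    sum_signedProd_sq (sum_neg_sq hx)]
  norm_num

/-- The first letter of the word already fixes the sign of a coordinate, so no word sees both `x`
and `-x`. For this reason words must be nonempty, and a word determines a side. -/
theorem signedProd_mul_neg (hm : 0 < m) (l : Fin m → Fin k × Bool) (x : Fin k → ℝ) :
    signedProd l x = 0 ∨ signedProd l (-x) = 0 := by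
  have h : signedPart x (l ⟨0, hm⟩) = 0 ∨ signedPart (-x) (l ⟨0, hm⟩) = 0 := by
    simp only [signedPart, Pi.neg_apply, neg_neg, max_eq_right_iff]
    split_ifs
    · rcases le_total (x (l ⟨0, hm⟩).1) 0 with h | h
      · exact Or.inl h
      · exact Or.inr (by linarith)
    · rcases le_total (x (l ⟨0, hm⟩).1) 0 with h | h
      · exact Or.inr h
      · exact Or.inl (by linarith)
  exact h.imp (fun h => Finset.prod_eq_zero (Finset.mem_univ _) h)
    (fun h => Finset.prod_eq_zero (Finset.mem_univ _) h)

theorem min_sq_le_mul {a b : ℝ} (ha : 0 ≤ a) (hb : 0 ≤ b) : min (a ^ 2) (b ^ 2) ≤ a * b := by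
  rcases le_total a b with h | h
  · exact (min_le_left _ _).trans (by nlinarith)
  · exact (min_le_right _ _).trans (by nlinarith)

theorem sum_min_signedProd_le {x y : Fin k → ℝ} (hx : ∑ i, x i ^ 2 = 1) (hy : ∑ i, y i ^ 2 = 1) :
    ∑ l : Fin m → Fin k × Bool, min (signedProd l x ^ 2) (signedProd l y ^ 2) ≤
      ((1 + ∑ i, x i * y i) / 2) ^ m := by
  calc _ ≤ ∑ l : Fin m → Fin k × Bool, signedProd l x * signedProd l y :=
        Finset.sum_le_sum fun l _ => min_sq_le_mul (signedProd_nonneg _ _) (signedProd_nonneg _ _)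
    _ ≤ _ := by
        rw [sum_signedProd_mul]
        exact pow_le_pow_left₀ (sum_signedPart_mul_nonneg _ _) (sum_signedPart_mul_le hx hy) m

/-- The overlap of the two distributions given by unit vectors at distance `√(2 - 2 c)`. -/
theorem one_sub_sum_min_signedProd_le {x y : Fin k → ℝ} (hx : ∑ i, x i ^ 2 = 1)
    (hy : ∑ i, y i ^ 2 = 1) :
    1 - ∑ l : Fin m → Fin k × Bool, min (signedProd l x ^ 2) (signedProd l y ^ 2) ≤
      √(m * (2 - 2 * ∑ i, x i * y i)) := by
  set s := ∑ l : Fin m → Fin k × Bool, min (signedProd l x ^ 2) (signedProd l y ^ 2) with hs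
  set ρ := ∑ e, signedPart x e * signedPart y e with hρ
  have hmax : ∑ l : Fin m → Fin k × Bool, max (signedProd l x ^ 2) (signedProd l y ^ 2) = 2 - s := by
    rw [hs, eq_sub_iff_add_eq, ← Finset.sum_add_distrib]
    simp only [max_add_min]
    rw [Finset.sum_add_distrib, sum_signedProd_sq hx, sum_signedProd_sq hy]
    norm_num
  -- The comparison of Hellinger and total variation distance: Cauchy–Schwarz on `min * max` gives
  -- `(1 - s)² ≤ 1 - ρ^(2m)`, and Bernoulli's inequality bounds this by `2m(1 - ρ)`.
  have hcs : (ρ ^ m) ^ 2 ≤ s * (2 - s) := by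
    rw [hρ, ← sum_signedProd_mul, ← hmax, hs]
    refine Finset.sum_sq_le_sum_mul_sum_of_sq_le_mul _ (fun l _ => by positivity)
      (fun l _ => by positivity) fun l _ => ?_
    rw [min_mul_max, mul_pow]
  have hc : ∑ i, x i * y i ≤ ρ := le_sum_signedPart_mul x y
  have hρ0 : 0 ≤ ρ := sum_signedPart_mul_nonneg x y
  have hb : 1 + (2 * m : ℕ) * (ρ - 1) ≤ ρ ^ (2 * m) := by
    have := one_add_mul_le_pow (show (-2 : ℝ) ≤ ρ - 1 by linarith) (2 * m)
    simpa using this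
  push_cast at hb
  refine Real.le_sqrt_of_sq_le ?_
  have hm0 : (0 : ℝ) ≤ m := Nat.cast_nonneg m
  have : ρ ^ (2 * m) = (ρ ^ m) ^ 2 := by rw [← pow_mul, mul_comm]
  nlinarith [mul_le_mul_of_nonneg_left hc hm0]

/-- On each word only one of `±x` and one of `±y` survives, so the overlap is half the sum of the
four overlaps of signed vectors, each bounded by the `m`-th power of the kernel. -/
theorem sum_min_tensorWeight_le {x y : Fin k → ℝ} (hm : 0 < m) (hx : ∑ i, x i ^ 2 = 1)
    (hy : ∑ i, y i ^ 2 = 1) :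
    ∑ l : Fin m → Fin k × Bool, min (tensorWeight l x) (tensorWeight l y) ≤
      ((1 + ∑ i, x i * y i) / 2) ^ m + ((1 - ∑ i, x i * y i) / 2) ^ m := by
  have hpt : ∀ l : Fin m → Fin k × Bool, min (tensorWeight l x) (tensorWeight l y) ≤
      (min (signedProd l x ^ 2) (signedProd l y ^ 2) +
        min (signedProd l x ^ 2) (signedProd l (-y) ^ 2) +
        min (signedProd l (-x) ^ 2) (signedProd l y ^ 2) +
        min (signedProd l (-x) ^ 2) (signedProd l (-y) ^ 2)) / 2 := fun l => by
    unfold tensorWeight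
    rcases signedProd_mul_neg hm l x with h | h <;> rcases signedProd_mul_neg hm l y with h' | h' <;>
      simp [h, h', min_div_div_right, sq_nonneg]
  have e1 := sum_min_signedProd_le (m := m) hx hy
  have e2 := sum_min_signedProd_le (m := m) hx (sum_neg_sq hy)
  have e3 := sum_min_signedProd_le (m := m) (sum_neg_sq hx) hy
  have e4 := sum_min_signedProd_le (m := m) (sum_neg_sq hx) (sum_neg_sq hy)
  simp only [Pi.neg_apply, mul_neg, neg_mul, neg_neg, Finset.sum_neg_distrib, ← sub_eq_add_neg]
    at e2 e3 e4
  refine (Finset.sum_le_sum fun l _ => hpt l).trans ?_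
  rw [← Finset.sum_div]
  simp only [Finset.sum_add_distrib]
  linarith

/-- A word seen by both `x` and `-y`, or by both `-x` and `y`, puts `x` and `y` on opposite sides.
The bound is therefore the overlap estimate for `x` and `-y`. -/
theorem one_sub_sum_opposite_le {x y : Fin k → ℝ} (hm : 0 < m) (hx : ∑ i, x i ^ 2 = 1)
    (hy : ∑ i, y i ^ 2 = 1) :
    (1 - ∑ l : Fin m → Fin k × Bool, if tensorSide l x ≠ tensorSide l y then
        min (tensorWeight l x) (tensorWeight l y) else 0) ≤
      √(m * (2 + 2 * ∑ i, x i * y i)) := by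
  have hpt : ∀ l : Fin m → Fin k × Bool,
      (min (signedProd l x ^ 2) (signedProd l (-y) ^ 2) +
        min (signedProd l (-x) ^ 2) (signedProd l y ^ 2)) / 2 ≤
      if tensorSide l x ≠ tensorSide l y then min (tensorWeight l x) (tensorWeight l y) else 0 := by
    intro l
    unfold tensorWeight tensorSide
    have p1 := signedProd_nonneg l x
    have p2 := signedProd_nonneg l y
    rcases p1.eq_or_lt with h1 | h1 <;> rcases p2.eq_or_lt with h2 | h2
    · simp [← h1, ← h2, sq_nonneg]
    · have h3 := (signedProd_mul_neg hm l y).resolve_left h2.ne'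
      simp [← h1, h2, h3, min_div_div_right]
    · have h3 := (signedProd_mul_neg hm l x).resolve_left h1.ne'
      simp [h1, ← h2, h3, min_div_div_right]
    · have h3 := (signedProd_mul_neg hm l y).resolve_left h2.ne'
      have h4 := (signedProd_mul_neg hm l x).resolve_left h1.ne'
      simp [h1, h2, h3, h4, sq_nonneg]
  have e2 := one_sub_sum_min_signedProd_le (m := m) hx (sum_neg_sq hy)
  have e3 := one_sub_sum_min_signedProd_le (m := m) (sum_neg_sq hx) hy
  simp only [Pi.neg_apply, mul_neg, neg_mul, Finset.sum_neg_distrib, sub_neg_eq_add] at e2 e3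
  have := Finset.sum_le_sum fun l (_ : l ∈ Finset.univ) => hpt l
  rw [← Finset.sum_div, Finset.sum_add_distrib] at this
  linarith

end

/-! ### Partitioning directions, and the mass of the classes. -/

open Finset in
theorem exists_partition_of_unit_vectors {V : Type*} [Fintype V] [DecidableEq V] {k m : ℕ}
    (hm : 0 < m) (x : V → Fin k → ℝ) (hx : ∀ v, ∑ i, x v i ^ 2 = 1) (a b : V → V → ℝ)
    (ha : ∀ u v, 0 ≤ a u v) (hb : ∀ u v, 0 ≤ b u v) {A : ℝ}
    (hA : ∑ u, ∑ v, 2 * a u v * √(m * (2 + 2 * ∑ i, x u i * x v i)) ≤ A)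
    (hB : ∑ u, ∑ v, b u v * (((1 + ∑ i, x u i * x v i) / 2) ^ m +
      ((1 - ∑ i, x u i * x v i) / 2) ^ m) ≤ 1 / 16) :
    ∃ (c : V → V) (τ : V → Bool),
      ∑ u, ∑ v, a u v * (if c u = c v ∧ τ u ≠ τ v then 0 else 1) ≤ 4 / 3 * A ∧
      ∑ u, ∑ v, b u v * (if c u = c v then 1 else 0) ≤ 1 / 4 := by
  have hA0 : 0 ≤ A := le_trans (sum_nonneg fun u _ => sum_nonneg fun v _ =>
    mul_nonneg (mul_nonneg zero_le_two (ha _ _)) (Real.sqrt_nonneg _)) hA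
  set X : (V → V) × (V → Bool) → ℝ := fun p =>
    ∑ u, ∑ v, a u v * (if p.1 u = p.1 v ∧ p.2 u ≠ p.2 v then 0 else 1) with hX
  set F : (V → V) × (V → Bool) → ℝ := fun p =>
    ∑ u, ∑ v, b u v * (if p.1 u = p.1 v then 1 else 0) with hF
  have hX0 : ∀ p, 0 ≤ X p := fun p => sum_nonneg fun u _ => sum_nonneg fun v _ =>
    mul_nonneg (ha _ _) (by split_ifs <;> norm_num)
  have hF0 : ∀ p, 0 ≤ F p := fun p => sum_nonneg fun u _ => sum_nonneg fun v _ =>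
    mul_nonneg (hb _ _) (by split_ifs <;> norm_num)
  have hex : ∀ ε : ℝ, 0 < ε → ∃ p, X p ≤ 4 / 3 * (A + ε) ∧ F p ≤ 1 / 4 := fun ε hε => by
    -- With this multiplier the single bound `X + t F ≤ A + t / 16` yields both `X ≤ 4/3 (A + ε)`
    -- and `F ≤ 1/4`. The `ε` keeps `t` positive when `A = 0`; it disappears at the end because
    -- there are finitely many partitions.
    set t := 16 / 3 * (A + ε) with ht
    have ht0 : 0 < t := by positivity
    obtain ⟨c, τ, h⟩ := exists_signed_partition
      (fun (l : Fin m → Fin k × Bool) v => tensorWeight l (x v)) (fun l v => tensorSide l (x v))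
      (fun l v => tensorWeight_nonneg l (x v)) (fun v => sum_tensorWeight (hx v))
      a (fun u v => t * b u v) ha (fun u v => mul_nonneg ht0.le (hb u v))
    have e1 : ∑ u, ∑ v, (a u v * (if c u = c v ∧ τ u ≠ τ v then 0 else 1) +
        t * b u v * (if c u = c v then 1 else 0)) = X (c, τ) + t * F (c, τ) := by
      simp only [hX, hF, mul_sum, ← sum_add_distrib, mul_assoc]
    rw [e1] at h
    have e2 : X (c, τ) + t * F (c, τ) ≤ A + t * (1 / 16) := by
      refine h.trans ((?_ : _ ≤ _).trans (add_le_add hA (mul_le_mul_of_nonneg_left hB ht0.le)))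
      rw [mul_sum, ← sum_add_distrib]
      refine sum_le_sum fun u _ => ?_
      rw [mul_sum, ← sum_add_distrib]
      refine sum_le_sum fun v _ => ?_
      rw [← mul_assoc]
      exact add_le_add
        (mul_le_mul_of_nonneg_left (one_sub_sum_opposite_le hm (hx u) (hx v))
          (mul_nonneg zero_le_two (ha u v)))
        (mul_le_mul_of_nonneg_left (sum_min_tensorWeight_le hm (hx u) (hx v))
          (mul_nonneg ht0.le (hb u v)))
    refine ⟨(c, τ), ?_, ?_⟩
    · have := mul_nonneg ht0.le (hF0 (c, τ))
      linarith
    · have := hX0 (c, τ)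
      by_contra! hlt
      have := mul_lt_mul_of_pos_left hlt ht0
      linarith
  obtain ⟨p, hp, hmin⟩ := exists_min_image {p | F p ≤ 1 / 4} X
    (by obtain ⟨p, -, hp⟩ := hex 1 one_pos; exact ⟨p, by simpa using hp⟩)
  rw [mem_filter] at hp
  refine ⟨p.1, p.2, le_of_forall_pos_le_add fun ε hε => ?_, hp.2⟩
  obtain ⟨p', h1, h2⟩ := hex (3 / 4 * ε) (by positivity)
  have := hmin p' (by simpa using h2)
  change X p ≤ _
  linarith

/-- For vectors of lengths `a`, `b` at cosine `c` with sum of length `N`, `N² - a b (2 + 2c) = (a -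
b)²`. This turns the rounding loss on an edge into a quantity suited to Cauchy–Schwarz. -/
theorem min_sq_mul_sqrt_le {a b c N m : ℝ} (ha : 0 ≤ a) (hb : 0 ≤ b) (hN : 0 ≤ N) (hm : 0 ≤ m)
    (hc : -1 ≤ c) (h : N ^ 2 = a ^ 2 + b ^ 2 + 2 * a * b * c) :
    2 * min (a ^ 2) (b ^ 2) * √(m * (2 + 2 * c)) ≤ √m * ((a + b) * N) := by
  have h1 : 2 * (a * b) * √(2 + 2 * c) ≤ (a + b) * N := by
    refine le_of_sq_le_sq ?_ (by positivity)
    have hs : √(2 + 2 * c) ^ 2 = 2 + 2 * c := Real.sq_sqrt (by linarith)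
    have h2 : a * b * (2 + 2 * c) ≤ N ^ 2 := by nlinarith [sq_nonneg (a - b)]
    have h3 : 4 * (a * b) ≤ (a + b) ^ 2 := by nlinarith [sq_nonneg (a - b)]
    calc (2 * (a * b) * √(2 + 2 * c)) ^ 2 = 4 * (a * b) * (a * b * (2 + 2 * c)) := by
          rw [mul_pow, hs]; ring
      _ ≤ (a + b) ^ 2 * N ^ 2 := by
          refine mul_le_mul h3 h2 ?_ (by positivity)
          exact mul_nonneg (mul_nonneg ha hb) (by linarith)
      _ = _ := by ring
  have h4 := min_sq_le_mul ha hb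
  rw [Real.sqrt_mul hm]
  calc 2 * min (a ^ 2) (b ^ 2) * (√m * √(2 + 2 * c)) ≤ 2 * (a * b) * (√m * √(2 + 2 * c)) := by
        gcongr
    _ = √m * (2 * (a * b) * √(2 + 2 * c)) := by ring
    _ ≤ _ := by gcongr

open Finset in
/-- If within each set a point of mass sees mass at most `K` up to an error `b`, then the total
excess of the class masses over `K` is at most the total error inside the classes. -/
theorem sum_excess_le {V : Type*} [Fintype V] [DecidableEq V] (c : V → V) (μ : V → ℝ)
    (b : V → V → ℝ) (hb : ∀ u v, 0 ≤ b u v) {K : ℝ} (hK : 1 ≤ K)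
    (h : ∀ u (s : Finset V), μ u * ∑ v ∈ s, μ v ≤ μ u * K + ∑ v ∈ s, b u v) :
    ∑ p, max (∑ v with c v = p, μ v - K) 0 ≤
      ∑ u, ∑ v, b u v * (if c u = c v then 1 else 0) := by
  have hr : ∑ u, ∑ v, b u v * (if c u = c v then 1 else 0) =
      ∑ p, ∑ u with c u = p, ∑ v with c v = p, b u v := by
    rw [← sum_fiberwise univ c]
    refine sum_congr rfl fun p _ => sum_congr rfl fun u hu => ?_
    rw [sum_filter]
    refine sum_congr rfl fun v _ => ?_
    rw [(mem_filter.1 hu).2]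
    simp [eq_comm]
  rw [hr]
  refine sum_le_sum fun p _ => ?_
  have h0 : 0 ≤ ∑ u with c u = p, ∑ v with c v = p, b u v :=
    sum_nonneg fun u _ => sum_nonneg fun v _ => hb u v
  refine max_le ?_ h0
  set M := ∑ v with c v = p, μ v with hM
  -- Summing the hypothesis over a class gives `M (M - K) ≤` its internal error; as `M > K ≥ 1` in
  -- the nontrivial case, the factor `M` can be dropped.
  have h1 : M * M ≤ M * K + ∑ u with c u = p, ∑ v with c v = p, b u v := by
    calc M * M = ∑ u with c u = p, μ u * M := by rw [← sum_mul]
      _ ≤ ∑ u with c u = p, (μ u * K + ∑ v with c v = p, b u v) := sum_le_sum fun u _ => h u _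
      _ = _ := by rw [sum_add_distrib, ← sum_mul]
  by_contra! hlt
  nlinarith

/-! ### Sweep cuts and the spectral embedding. -/

namespace WeightedGraph

theorem stubWeight_filter {V : Type*} [Fintype V] (G : WeightedGraph V) (p : V → V → Prop) [∀ u v, Decidable (p u v)] :
    G.stubWeight (Finset.univ.filter fun s => p s.1 s.2) =
      ∑ u, ∑ v, if p u v then G.weight u v else 0 := by
  rw [stubWeight, Finset.sum_filter, Fintype.sum_prod_type]

variable {V : Type*} [Fintype V] [DecidableEq V] (G : WeightedGraph V)

open Finset in
/-- A sweep over the superlevel sets of `q`, each split into two sides by `τ`. -/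
theorem exists_bipartiteConductance_le (hdeg : ∀ v, 0 < G.degree v) (q : V → ℝ)
    (hq : ∀ v, 0 ≤ q v) (τ : V → Bool) (hne : ∃ v, 0 < q v) :
    ∃ S S' : Finset V, (S ∪ S').Nonempty ∧ Disjoint S S' ∧ (∀ v ∈ S ∪ S', 0 < q v) ∧
      G.bipartiteConductance S S' ≤
        (∑ u, ∑ v, G.weight u v * (q u - if τ u ≠ τ v then min (q u) (q v) else 0)) /
          ∑ v, G.degree v * q v := by
  set N := ∑ u, ∑ v, G.weight u v * (q u - if τ u ≠ τ v then min (q u) (q v) else 0) with hN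
  set M := ∑ v, G.degree v * q v with hM
  have hM0 : 0 < M := by
    obtain ⟨v, hv⟩ := hne
    exact sum_pos' (fun v _ => mul_nonneg (hdeg v).le (hq v)) ⟨v, mem_univ _, mul_pos (hdeg v) hv⟩
  have hNM : N = M - ∑ u, ∑ v, if τ u ≠ τ v then G.weight u v * min (q u) (q v) else 0 := by
    rw [hN, hM, ← sum_sub_distrib]
    refine sum_congr rfl fun u _ => ?_
    rw [degree, sum_mul, ← sum_sub_distrib]
    refine sum_congr rfl fun v _ => ?_
    split_ifs <;> ring
  -- Diagonal coefficients encode the linear term, as `min (q u) (q u) = q u`. The functional is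
  -- then `M (1 - N / M) - (M - N) = 0`, and its nonpositivity on a superlevel set is the
  -- conductance bound `N / M`.
  obtain ⟨t, ht, ⟨w, -, hw⟩, h⟩ := exists_superlevel_nonpos univ
    (fun u v => (if u = v then G.degree u * (1 - N / M) else 0) -
      if τ u ≠ τ v then G.weight u v else 0) (fun _ _ => 0) q hq
    (by obtain ⟨v, hv⟩ := hne; exact ⟨v, mem_univ _, hv⟩) (by
      have : ∑ u, ∑ v, (((if u = v then G.degree u * (1 - N / M) else 0) -
          if τ u ≠ τ v then G.weight u v else 0) * min (q u) (q v) + 0 * max (q u) (q v)) =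
          M * (1 - N / M) -
          ∑ u, ∑ v, if τ u ≠ τ v then G.weight u v * min (q u) (q v) else 0 := by
        simp only [zero_mul, add_zero, sub_mul, sum_sub_distrib, ite_mul, sum_ite_eq, mem_univ,
          if_true, min_self, hM, sum_mul]
        congr 1
        exact sum_congr rfl fun u _ => by ring
      rw [this, mul_sub, mul_div_cancel₀ _ hM0.ne', hNM]
      linarith)
  set U : Finset V := {v | t ≤ q v} with hU
  have hunion : U.filter (fun v => τ v = true) ∪ U.filter (fun v => τ v = false) = U := by
    ext v; cases h : τ v <;> simp [h]
  refine ⟨U.filter fun v => τ v = true, U.filter fun v => τ v = false, ?_, ?_, ?_, ?_⟩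
  · rw [hunion]; exact ⟨w, by simpa [hU] using hw⟩
  · rw [disjoint_filter]
    intro v _ h; simp [h]
  · rw [hunion]; intro v hv
    exact ht.trans_le (by simpa [hU] using hv)
  have hvol : G.stubWeight (coloredStubs U) = ∑ u, if t ≤ q u then G.degree u else 0 := by
    rw [coloredStubs, G.stubWeight_filter fun u _ => u ∈ U]
    refine sum_congr rfl fun u _ => ?_
    by_cases h : t ≤ q u <;> simp [hU, h, degree]
  have hnum : G.stubWeight (badStubs U ∪ innerStubs (U.filter fun v => τ v = true)
      (U.filter fun v => τ v = false)) = ∑ u, ∑ v, ((if t ≤ q u then G.weight u v else 0) -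
        if τ u ≠ τ v then (if t ≤ q u ∧ t ≤ q v then G.weight u v else 0) else 0) := by
    rw [badStubs, innerStubs, ← filter_or, G.stubWeight_filter fun u v => (u ∈ U ∧ v ∉ U) ∨
      (u ∈ U.filter fun v => τ v = true) ∧ (v ∈ U.filter fun v => τ v = true) ∨
      (u ∈ U.filter fun v => τ v = false) ∧ (v ∈ U.filter fun v => τ v = false)]
    refine sum_congr rfl fun u _ => sum_congr rfl fun v _ => ?_
    by_cases h1 : t ≤ q u <;> by_cases h2 : t ≤ q v <;> cases h3 : τ u <;> cases h4 : τ v <;>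
      simp [hU, h1, h2, h3, h4]
  rw [bipartiteConductance, hunion, hvol, hnum, div_le_iff₀]
  · have h' : ∑ u, ∑ v, ((if u = v then (if t ≤ q u then G.degree u * (1 - N / M) else 0) else 0) -
        if τ u ≠ τ v then (if t ≤ q u ∧ t ≤ q v then G.weight u v else 0) else 0) ≤ 0 := by
      refine le_of_eq_of_le (sum_congr rfl fun u _ => sum_congr rfl fun v _ => ?_) h
      by_cases h1 : u = v
      · subst h1; simp
      · by_cases h2 : τ u = τ v
        · simp [h1, h2]
        · simp only [h1, h2, if_false, ne_eq, not_false_eq_true, if_true]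
          split_ifs <;> simp
    simp only [sum_sub_distrib, sum_ite_eq, mem_univ, if_true] at h' ⊢
    have e1 : ∑ u, ∑ v, (if t ≤ q u then G.weight u v else 0) =
        ∑ u, if t ≤ q u then G.degree u else 0 := by
      refine sum_congr rfl fun u _ => ?_
      by_cases h : t ≤ q u <;> simp [h, degree]
    have e2 : ∑ u, (if t ≤ q u then G.degree u * (1 - N / M) else 0) =
        (∑ u, if t ≤ q u then G.degree u else 0) * (1 - N / M) := by
      rw [sum_mul]
      exact sum_congr rfl fun u _ => by split_ifs <;> simp
    rw [e2] at h'
    rw [e1]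
    linarith
  · refine sum_pos' (fun u _ => ?_) ⟨w, mem_univ _, ?_⟩
    · split_ifs
      · exact (hdeg u).le
      · rfl
    · simpa [hw] using hdeg w

open Finset in
/-- The embedding by the eigenvectors of the `k` largest eigenvalues of the normalized Laplacian. -/
theorem exists_spectral_embedding (hdeg : ∀ v, 0 < G.degree v) (k : ℕ) (hk1 : 1 ≤ k)
    (hk : k ≤ Fintype.card V) :
    ∃ f : V → EuclideanSpace ℝ (Fin k),
      (∀ i j, ∑ v, G.degree v * (f v i * f v j) = if i = j then 1 else 0) ∧
      ∑ u, ∑ v, G.weight u v * ‖f u + f v‖ ^ 2 = 2 * (k * G.avgTopGap k hk) := by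
  set hL := G.normLaplacian_isHermitian
  -- The same equivalence that defines `eigenvalues` from the nonincreasing `eigenvalues₀`, so the
  -- first `k` indices pick the largest eigenvalues.
  let e : Fin (Fintype.card V) ≃ V := Fintype.equivOfCardEq (Fintype.card_fin _)
  let idx : Fin k → V := fun i => e (Fin.castLE hk i)
  have hidx : Function.Injective idx := e.injective.comp (Fin.castLE_injective hk)
  have hev : ∀ i, hL.eigenvalues (idx i) = hL.eigenvalues₀ (Fin.castLE hk i) := fun i => by
    simp [Matrix.IsHermitian.eigenvalues, idx, e]
  let g : Fin k → V → ℝ := fun i v => hL.eigenvectorBasis (idx i) v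
  have hgg : ∀ i j, ∑ v, g i v * g j v = if i = j then 1 else 0 := fun i j => by
    have := orthonormal_iff_ite.1 hL.eigenvectorBasis.orthonormal (idx j) (idx i)
    simp only [PiLp.inner_apply, RCLike.inner_apply, conj_trivial, hidx.eq_iff] at this
    rw [this]
    simp [eq_comm]
  have hs : ∀ v, 0 < √(G.degree v) := fun v => Real.sqrt_pos.2 (hdeg v)
  have hss : ∀ v, √(G.degree v) * √(G.degree v) = G.degree v := fun v =>
    Real.mul_self_sqrt (hdeg v).le
  let f : V → EuclideanSpace ℝ (Fin k) := fun v => WithLp.toLp 2 fun i => g i v / √(G.degree v)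
  have hfg : ∀ v i, g i v = √(G.degree v) * f v i := fun v i => by
    simp only [f]; rw [mul_div_cancel₀ _ (hs v).ne']
  have hff : ∀ i j, ∑ v, G.degree v * (f v i * f v j) = if i = j then 1 else 0 := fun i j => by
    rw [← hgg]
    refine sum_congr rfl fun v _ => ?_
    rw [hfg v i, hfg v j]
    linear_combination -(f v i * f v j) * hss v
  -- The eigenvector equation in the form `A f = (1 - λ) D f`.
  have heig : ∀ i u, ∑ v, G.weight u v * f v i =
      (1 - hL.eigenvalues (idx i)) * (G.degree u * f u i) := fun i u => by
    have h := congrFun (hL.mulVec_eigenvectorBasis (idx i)) u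
    have h1 : (G.normLaplacian.mulVec (g i)) u =
        (√(G.degree u))⁻¹ * (G.degree u * f u i - ∑ v, G.weight u v * f v i) := by
      rw [normLaplacian, invSqrtDegMatrix, ← Matrix.mulVec_mulVec, ← Matrix.mulVec_mulVec,
        Matrix.mulVec_diagonal]
      have : (Matrix.diagonal fun v => (√(G.degree v))⁻¹).mulVec (g i) = fun v => f v i := by
        ext v
        rw [Matrix.mulVec_diagonal, hfg, inv_mul_cancel_left₀ (hs v).ne']
      rw [this, Matrix.sub_mulVec, degMatrix, Pi.sub_apply, Matrix.mulVec_diagonal]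
      rfl
    have h2 : (G.normLaplacian.mulVec (g i)) u = hL.eigenvalues (idx i) * g i u := h
    rw [h1, hfg, inv_mul_eq_iff_eq_mul₀ (hs u).ne'] at h2
    have := hss u
    linear_combination -h2 - hL.eigenvalues (idx i) * f u i * this
  refine ⟨f, hff, ?_⟩
  have hcoord : ∀ i, ∑ u, ∑ v, G.weight u v * (f u i + f v i) ^ 2 =
      2 * (2 - hL.eigenvalues (idx i)) := fun i => by
    have h1 : ∑ u, ∑ v, G.weight u v * (f u i * f u i) = 1 := by
      have := hff i i
      rw [if_pos rfl] at this
      rw [← this]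
      exact sum_congr rfl fun u _ => by rw [← sum_mul]; rfl
    have h2 : ∑ u, ∑ v, G.weight u v * (f v i * f v i) = 1 := by
      rw [← h1, sum_comm]
      exact sum_congr rfl fun u _ => sum_congr rfl fun v _ => by rw [G.symm]
    have h3 : ∑ u, ∑ v, f u i * (G.weight u v * f v i) = 1 - hL.eigenvalues (idx i) := by
      have := hff i i
      rw [if_pos rfl] at this
      simp only [← mul_sum, heig]
      calc _ = (1 - hL.eigenvalues (idx i)) * ∑ u, G.degree u * (f u i * f u i) := by
            rw [mul_sum]; exact sum_congr rfl fun u _ => by ring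
        _ = _ := by rw [this, mul_one]
    have h4 : ∑ u, ∑ v, G.weight u v * (f u i + f v i) ^ 2 =
        ∑ u, ∑ v, G.weight u v * (f u i * f u i) + ∑ u, ∑ v, G.weight u v * (f v i * f v i) +
        2 * ∑ u, ∑ v, f u i * (G.weight u v * f v i) := by
      simp only [mul_sum, ← sum_add_distrib]
      exact sum_congr rfl fun u _ => sum_congr rfl fun v _ => by ring
    rw [h4, h1, h2, h3]; ring
  have hk0 : (k : ℝ) ≠ 0 := by positivity
  rw [avgTopGap, mul_div_cancel₀ _ hk0, mul_sum]
  simp only [EuclideanSpace.norm_sq_eq, Real.norm_eq_abs, sq_abs, PiLp.add_apply, mul_sum]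
  calc _ = ∑ i, ∑ u, ∑ v, G.weight u v * (f u i + f v i) ^ 2 := by
        exact (sum_congr rfl fun u _ => sum_comm).trans sum_comm
    _ = _ := by
        refine sum_congr rfl fun i _ => ?_
        rw [hcoord, hev, eigenvalue, Fin.rev_rev]

end WeightedGraph

/-! ### Assembling the communities for general `r`, `s` and `m`. -/

namespace WeightedGraph

variable {V : Type*} [Fintype V] [DecidableEq V] (G : WeightedGraph V)

-- In `hr`, `3/4` is `1/4` for the total excess of the classes over `1/s` plus the `1/2` lost in
-- greedy grouping. In `hp`, `1/(16 k²)` makes the overlaps of dissimilar pairs, weighted by total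
-- mass `k²`, add up to at most `1/16`.
open Finset in
theorem exists_isDisjointCommunities (hdeg : ∀ v, 0 < G.degree v) (k : ℕ) (hk1 : 1 ≤ k)
    (hk : k ≤ Fintype.card V) {r m : ℕ} (hm : 0 < m) {s : ℝ} (hs0 : 0 < s) (hs1 : s ≤ 1)
    (hr : ((r : ℝ) - 1) / s + 3 / 4 < k)
    (hp : ∀ c : ℝ, c ^ 2 < s → ((1 + c) / 2) ^ m + ((1 - c) / 2) ^ m ≤ 1 / (16 * (k : ℝ) ^ 2)) :
    ∃ S S' : Fin r → Finset V, IsDisjointCommunities S S' ∧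
      ∀ i : Fin r, G.bipartiteConductance (S i) (S' i) ≤
        2 * (1 + 8 / 3 * √m) * k * √(2 * G.avgTopGap k hk) / (r - i) := by
  have hk0 : (0 : ℝ) < k := by exact_mod_cast hk1
  obtain ⟨f, hiso, hen⟩ := G.exists_spectral_embedding hdeg k hk1 hk
  set n : V → ℝ := fun v => ‖f v‖ with hn
  have hn0 : ∀ v, 0 ≤ n v := fun v => norm_nonneg _
  have hn2 : ∀ v, n v ^ 2 = ∑ i, f v i ^ 2 := fun v => by
    simp [hn, EuclideanSpace.norm_sq_eq]
  have hunit : ∀ v, ∃ y : Fin k → ℝ, ∑ i, y i ^ 2 = 1 ∧ ∀ i, f v i = n v * y i := fun v => by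
    by_cases h : f v = 0
    -- A zero vector gets an arbitrary direction; its mass is zero.
    · exact ⟨Pi.single ⟨0, hk1⟩ 1, by simp [Pi.single_apply], by simp [hn, h]⟩
    · have hv : n v ≠ 0 := norm_ne_zero_iff.2 h
      refine ⟨fun i => f v i / n v, ?_, fun i => by rw [mul_div_cancel₀ _ hv]⟩
      simp only [div_pow]
      rw [← sum_div, ← hn2, div_self (pow_ne_zero 2 hv)]
  choose x hx hfx using hunit
  set ip : V → V → ℝ := fun u v => ∑ i, x u i * x v i with hip
  have hip1 : ∀ u v, -1 ≤ ip u v := fun u v => by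
    have h : 0 ≤ ∑ i, (x u i + x v i) ^ 2 := sum_nonneg fun i _ => sq_nonneg _
    have e : ∑ i, (x u i + x v i) ^ 2 = ∑ i, x u i ^ 2 + ∑ i, x v i ^ 2 + 2 * ip u v := by
      rw [hip, mul_sum, ← sum_add_distrib, ← sum_add_distrib]
      exact sum_congr rfl fun i _ => by ring
    rw [e, hx, hx] at h
    linarith
  have hnorm : ∀ u v, ‖f u + f v‖ ^ 2 = n u ^ 2 + n v ^ 2 + 2 * n u * n v * ip u v := fun u v => by
    rw [EuclideanSpace.norm_sq_eq, hn2, hn2, hip, mul_sum, ← sum_add_distrib, ← sum_add_distrib]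
    refine sum_congr rfl fun i _ => ?_
    rw [Real.norm_eq_abs, sq_abs, PiLp.add_apply, hfx, hfx]
    ring
  set μ : V → ℝ := fun v => G.degree v * n v ^ 2 with hμ
  have hμ0 : ∀ v, 0 ≤ μ v := fun v => mul_nonneg (hdeg v).le (sq_nonneg _)
  have hμk : ∑ v, μ v = k := by
    simp only [hμ, hn2, mul_sum]
    rw [sum_comm]
    have : ∀ i, ∑ v, G.degree v * f v i ^ 2 = 1 := fun i => by
      simpa [sq] using hiso i i
    simp [this]
  have hμip : ∀ u, ∑ v, μ v * ip u v ^ 2 = 1 := fun u => by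
    have e : ∀ v, μ v * ip u v ^ 2 =
        ∑ i, ∑ j, x u i * x u j * (G.degree v * (f v i * f v j)) := fun v => by
      rw [hμ, hip, sq (∑ i, _), sum_mul_sum, mul_sum]
      refine sum_congr rfl fun i _ => ?_
      rw [mul_sum]
      refine sum_congr rfl fun j _ => ?_
      rw [hfx, hfx]; ring
    simp only [e]
    rw [sum_comm]
    calc _ = ∑ i, ∑ j, x u i * x u j * ∑ v, G.degree v * (f v i * f v j) := by
          refine sum_congr rfl fun i _ => ?_
          rw [sum_comm]
          exact sum_congr rfl fun j _ => by rw [mul_sum]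
      _ = 1 := by simp [hiso, ← sq, hx]
  set W := ∑ u, ∑ v, G.weight u v * ((n u + n v) * ‖f u + f v‖) with hW
  have hWle : W ≤ 2 * k * √(2 * G.avgTopGap k hk) := by
    have hdn : ∑ u, ∑ v, G.weight u v * n u ^ 2 = k := by
      rw [← hμk]
      exact sum_congr rfl fun u _ => by rw [← sum_mul]; rfl
    have hdn' : ∑ u, ∑ v, G.weight u v * n v ^ 2 = k := by
      rw [← hdn, sum_comm]
      exact sum_congr rfl fun u _ => sum_congr rfl fun v _ => by rw [G.symm]
    have h1 : ∑ u, ∑ v, G.weight u v * (n u + n v) ^ 2 ≤ 4 * k := by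
      calc ∑ u, ∑ v, G.weight u v * (n u + n v) ^ 2 ≤
          ∑ u, ∑ v, (2 * (G.weight u v * n u ^ 2) + 2 * (G.weight u v * n v ^ 2)) := by
            refine sum_le_sum fun u _ => sum_le_sum fun v _ => ?_
            nlinarith [mul_nonneg (G.nonneg u v) (sq_nonneg (n u - n v))]
        _ = 4 * k := by
            simp only [sum_add_distrib, ← mul_sum]
            rw [hdn, hdn']; ring
    have h2 : W ^ 2 ≤ (∑ u, ∑ v, G.weight u v * (n u + n v) ^ 2) *
        ∑ u, ∑ v, G.weight u v * ‖f u + f v‖ ^ 2 := by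
      rw [hW]
      simp only [← Fintype.sum_prod_type']
      refine sum_sq_le_sum_mul_sum_of_sq_le_mul _ (fun p _ => ?_) (fun p _ => ?_) fun p _ => ?_
      · exact mul_nonneg (G.nonneg _ _) (sq_nonneg _)
      · exact mul_nonneg (G.nonneg _ _) (sq_nonneg _)
      · exact le_of_eq (by ring)
    rw [hen] at h2
    have hR : 0 ≤ G.avgTopGap k hk := by
      have : 0 ≤ ∑ u, ∑ v, G.weight u v * ‖f u + f v‖ ^ 2 :=
        sum_nonneg fun u _ => sum_nonneg fun v _ => mul_nonneg (G.nonneg _ _) (sq_nonneg _)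
      rw [hen] at this
      by_contra! hlt
      nlinarith [mul_pos_of_neg_of_neg hlt (neg_neg_of_pos hk0)]
    refine le_of_sq_le_sq ?_ (by positivity)
    rw [mul_pow, Real.sq_sqrt (by positivity)]
    have := mul_le_mul_of_nonneg_right h1 (show 0 ≤ 2 * (k * G.avgTopGap k hk) by positivity)
    nlinarith
  set b : V → V → ℝ := fun u v => if ip u v ^ 2 < s then μ u * μ v else 0 with hb
  have hb0 : ∀ u v, 0 ≤ b u v := fun u v => by
    simp only [hb]; split_ifs
    · exact mul_nonneg (hμ0 u) (hμ0 v)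
    · rfl
  obtain ⟨c, τ, hbad, hfar⟩ := exists_partition_of_unit_vectors hm x hx
    (fun u v => G.weight u v * min (n u ^ 2) (n v ^ 2)) b
    (fun u v => mul_nonneg (G.nonneg u v) (le_min (sq_nonneg _) (sq_nonneg _))) hb0
    (A := √m * W) (by
      rw [hW, mul_sum]
      refine sum_le_sum fun u _ => ?_
      rw [mul_sum]
      refine sum_le_sum fun v _ => ?_
      have := mul_le_mul_of_nonneg_left (min_sq_mul_sqrt_le (hn0 u) (hn0 v) (norm_nonneg _)
        (Nat.cast_nonneg m) (hip1 u v) (hnorm u v)) (G.nonneg u v)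
      linarith)
    (by
      calc _ ≤ ∑ u, ∑ v, μ u * μ v * (1 / (16 * (k : ℝ) ^ 2)) := by
            refine sum_le_sum fun u _ => sum_le_sum fun v _ => ?_
            simp only [hb]
            split_ifs with h
            · exact mul_le_mul_of_nonneg_left (hp _ h) (mul_nonneg (hμ0 u) (hμ0 v))
            · rw [zero_mul]
              have := mul_nonneg (hμ0 u) (hμ0 v)
              positivity
        _ = 1 / 16 := by
            simp only [← sum_mul, ← mul_sum, hμk]
            field_simp)
  have hexc := sum_excess_le c μ b hb0 (K := 1 / s) (by rw [le_div_iff₀ hs0]; linarith)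
    fun u t => by
      have hpt : ∀ v, μ u * μ v ≤ μ u * (μ v * ip u v ^ 2 / s) + b u v := fun v => by
        simp only [hb]
        split_ifs with h
        · have := mul_nonneg (hμ0 u) (mul_nonneg (hμ0 v) (sq_nonneg (ip u v)))
          have := div_nonneg (mul_nonneg (hμ0 v) (sq_nonneg (ip u v))) hs0.le
          have := mul_nonneg (hμ0 u) this
          linarith
        · rw [add_zero]
          refine mul_le_mul_of_nonneg_left ?_ (hμ0 u)
          rw [le_div_iff₀ hs0]
          exact mul_le_mul_of_nonneg_left (not_lt.1 h) (hμ0 v)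
      rw [mul_sum]
      refine (sum_le_sum fun v _ => hpt v).trans ?_
      rw [sum_add_distrib, ← mul_sum, ← sum_div]
      gcongr
      · exact hμ0 u
      · rw [← hμip u]
        exact sum_le_univ_sum_of_nonneg fun v => mul_nonneg (hμ0 v) (sq_nonneg _)
  have hcells : ∑ p, ∑ v with c v = p, μ v = k := by rw [sum_fiberwise, hμk]
  obtain ⟨P, -, hPd, hPm⟩ := exists_disjoint_groups (fun p => ∑ v with c v = p, μ v)
    (K := 1 / s) (by rw [le_div_iff₀ hs0]; linarith) r univ (by
      rw [hcells, mul_one_div]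
      linarith)
  set q : Fin r → V → ℝ := fun i v => if c v ∈ P i then n v ^ 2 else 0 with hq
  have hq0 : ∀ i v, 0 ≤ q i v := fun i v => by
    simp only [hq]; split_ifs
    · exact sq_nonneg _
    · rfl
  have hmass : ∀ i, 1 / 2 ≤ ∑ v, G.degree v * q i v := fun i => by
    refine (hPm i).trans_eq ?_
    simp only [hq, mul_ite, mul_zero]
    rw [← sum_filter, sum_fiberwise_eq_sum_filter]
  set N : Fin r → ℝ := fun i =>
    ∑ u, ∑ v, G.weight u v * (q i u - if τ u ≠ τ v then min (q i u) (q i v) else 0) with hN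
  have hN0 : ∀ i, 0 ≤ N i := fun i => sum_nonneg fun u _ => sum_nonneg fun v _ => by
    refine mul_nonneg (G.nonneg u v) ?_
    split_ifs
    · exact sub_nonneg.2 (min_le_left _ _)
    · simpa using hq0 i u
  have hNsum : ∑ i, N i ≤ (1 / 2 + 4 / 3 * √m) * W := by
    -- Each vertex lies in at most one group, and a group is a union of whole classes, so
    -- opposite-side pairs within a class keep their saving.
    have h1 : ∑ i, N i ≤ ∑ u, ∑ v, G.weight u v *
        (n u ^ 2 - if c u = c v ∧ τ u ≠ τ v then min (n u ^ 2) (n v ^ 2) else 0) := by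
      simp only [hN]
      rw [sum_comm]
      refine sum_le_sum fun u _ => ?_
      rw [sum_comm]
      refine sum_le_sum fun v _ => ?_
      rw [← mul_sum]
      refine mul_le_mul_of_nonneg_left ?_ (G.nonneg u v)
      have hrhs : 0 ≤ n u ^ 2 - if c u = c v ∧ τ u ≠ τ v then min (n u ^ 2) (n v ^ 2) else 0 := by
        split_ifs
        · exact sub_nonneg.2 (min_le_left _ _)
        · simpa using sq_nonneg (n u)
      have hzero : ∀ i, c u ∉ P i →
          (q i u - if τ u ≠ τ v then min (q i u) (q i v) else 0) = 0 := fun i hi => by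
        simp only [hq, hi, if_false, zero_sub, neg_eq_zero, ite_eq_right_iff, min_eq_left_iff]
        intro _
        split_ifs
        · exact sq_nonneg _
        · rfl
      by_cases hi : ∃ i, c u ∈ P i
      · obtain ⟨i, hi⟩ := hi
        rw [sum_eq_single i (fun j _ hj => hzero j fun h =>
          disjoint_left.1 (hPd j i hj) h hi) (by simp)]
        have hqu : q i u = n u ^ 2 := by simp [hq, hi]
        rw [hqu]
        by_cases hc : c u = c v
        · have hqv : q i v = n v ^ 2 := by simp [hq, ← hc, hi]
          simp [hc, hqv]
        · have : 0 ≤ min (n u ^ 2) (q i v) := le_min (sq_nonneg _) (hq0 i v)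
          simp only [hc, false_and, if_false]
          split_ifs <;> linarith
      · push Not at hi
        rw [sum_eq_zero fun i _ => hzero i (hi i)]
        exact hrhs
    -- `n u ^ 2 - min` is half of a difference plus half of its absolute value; the antisymmetric
    -- half cancels over ordered pairs.
    have h2 : ∑ u, ∑ v, G.weight u v * (n u ^ 2 - n v ^ 2) = 0 := by
      have : ∑ u, ∑ v, G.weight u v * (n u ^ 2 - n v ^ 2) =
          ∑ u, ∑ v, G.weight u v * (n v ^ 2 - n u ^ 2) := by
        rw [sum_comm]
        exact sum_congr rfl fun u _ => sum_congr rfl fun v _ => by rw [G.symm]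
      have e : ∑ u, ∑ v, G.weight u v * (n v ^ 2 - n u ^ 2) =
          -∑ u, ∑ v, G.weight u v * (n u ^ 2 - n v ^ 2) := by
        simp only [← sum_neg_distrib]
        exact sum_congr rfl fun u _ => sum_congr rfl fun v _ => by ring
      linarith
    have h3 : ∑ u, ∑ v, G.weight u v *
        (n u ^ 2 - if c u = c v ∧ τ u ≠ τ v then min (n u ^ 2) (n v ^ 2) else 0) ≤
        ∑ u, ∑ v, (1 / 2 * (G.weight u v * (n u ^ 2 - n v ^ 2)) +
          1 / 2 * (G.weight u v * ((n u + n v) * ‖f u + f v‖)) +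
          G.weight u v * min (n u ^ 2) (n v ^ 2) *
            (if c u = c v ∧ τ u ≠ τ v then 0 else 1)) := by
      refine sum_le_sum fun u _ => sum_le_sum fun v _ => ?_
      have habs : |n u - n v| ≤ ‖f u + f v‖ := by
        have := abs_norm_sub_norm_le (f u) (-f v)
        rwa [norm_neg, sub_neg_eq_add] at this
      have hd : |n u ^ 2 - n v ^ 2| ≤ (n u + n v) * ‖f u + f v‖ := by
        rw [sq_sub_sq, abs_mul, abs_of_nonneg (add_nonneg (hn0 u) (hn0 v))]
        exact mul_le_mul_of_nonneg_left habs (add_nonneg (hn0 u) (hn0 v))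
      have hmin : n u ^ 2 - min (n u ^ 2) (n v ^ 2) ≤
          1 / 2 * (n u ^ 2 - n v ^ 2) + 1 / 2 * ((n u + n v) * ‖f u + f v‖) := by
        have h1 := le_abs_self (n u ^ 2 - n v ^ 2)
        have h2 := neg_abs_le (n u ^ 2 - n v ^ 2)
        rcases le_total (n u ^ 2) (n v ^ 2) with h | h <;> simp only [h, min_eq_left, min_eq_right] <;>
          linarith
      have := mul_le_mul_of_nonneg_left hmin (G.nonneg u v)
      split_ifs <;> linarith
    simp only [sum_add_distrib, ← mul_sum] at h3
    rw [h2, ← hW] at h3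
    linarith
  have hex : ∀ i, ∃ S S' : Finset V, (S ∪ S').Nonempty ∧ Disjoint S S' ∧
      (∀ v ∈ S ∪ S', 0 < q i v) ∧
      G.bipartiteConductance S S' ≤ N i / ∑ v, G.degree v * q i v := fun i => by
    refine G.exists_bipartiteConductance_le hdeg (q i) (hq0 i) τ ?_
    by_contra! h
    have h0 : ∀ v, q i v = 0 := fun v => le_antisymm (h v) (hq0 i v)
    have := hmass i
    simp [h0] at this
    norm_num at this
  choose S S' hSne hSd hSq hS using hex
  obtain ⟨e, he⟩ := exists_perm_le_sum_div (fun i => N i / ∑ v, G.degree v * q i v)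
    fun i => div_nonneg (hN0 i) (by linarith [hmass i])
  refine ⟨S ∘ e, S' ∘ e, ⟨fun i => hSne _, fun i => hSd _, fun i j hij => ?_⟩, fun i => ?_⟩
  · rw [disjoint_left]
    intro v hv hv'
    have hmem : ∀ i, v ∈ S i ∪ S' i → c v ∈ P i := fun i h => by
      by_contra hcv
      simpa [hq, hcv] using hSq i v h
    exact disjoint_left.1 (hPd _ _ (e.injective.ne hij)) (hmem _ hv) (hmem _ hv')
  · refine (hS (e i)).trans ((he i).trans ?_)
    have hi : (0 : ℝ) < r - i := by
      rw [sub_pos]; exact_mod_cast i.2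
    refine div_le_div_of_nonneg_right ?_ hi.le
    calc ∑ j, N j / ∑ v, G.degree v * q j v ≤ ∑ j, 2 * N j := by
          refine sum_le_sum fun j _ => ?_
          have := hmass j
          rw [div_le_iff₀ (by linarith)]
          nlinarith [hN0 j]
      _ = 2 * ∑ j, N j := by rw [mul_sum]
      _ ≤ (1 + 8 / 3 * √m) * W := by linarith
      _ ≤ (1 + 8 / 3 * √m) * (2 * k * √(2 * G.avgTopGap k hk)) := by gcongr
      _ = _ := by ring

end WeightedGraph

/-! ### Choice of the parameters and numerical bounds. -/

theorem half_pow_add_half_pow_le {c d : ℝ} (m : ℕ) (hd : 0 ≤ d) (hc : c ^ 2 ≤ (1 - 2 * d) ^ 2)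
    (hd' : d ≤ 1 / 2) :
    ((1 + c) / 2) ^ m + ((1 - c) / 2) ^ m ≤ 2 * Real.exp (-(m * d)) := by
  have h := abs_le_of_sq_le_sq' hc (by linarith)
  have he : 1 - d ≤ Real.exp (-d) := by linarith [Real.add_one_le_exp (-d)]
  have hm : Real.exp (-(m * d)) = Real.exp (-d) ^ m := by
    rw [← Real.exp_nat_mul]; ring_nf
  have h1 : ((1 + c) / 2) ^ m ≤ Real.exp (-d) ^ m :=
    pow_le_pow_left₀ (by linarith) (by linarith) m
  have h2 : ((1 - c) / 2) ^ m ≤ Real.exp (-d) ^ m :=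
    pow_le_pow_left₀ (by linarith) (by linarith) m
  linarith

theorem twenty_le_exp_three : (20 : ℝ) ≤ Real.exp 3 := by
  have h : Real.exp 3 = Real.exp 1 ^ 3 := by rw [← Real.exp_nat_mul]; norm_num
  rw [h]
  calc (20 : ℝ) ≤ 2.7182818283 ^ 3 := by norm_num
    _ ≤ _ := pow_le_pow_left₀ (by norm_num) Real.exp_one_gt_d9.le 3

theorem mul_sq_le_exp {k : ℕ} (hk : 2 ≤ k) : 32 * (k : ℝ) ^ 2 ≤ Real.exp (3 * k) := by
  have h1 : Real.exp (3 * k) = Real.exp 3 ^ k := by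
    rw [← Real.exp_nat_mul]; ring_nf
  rw [h1]
  refine le_trans ?_ (pow_le_pow_left₀ (by norm_num) twenty_le_exp_three k)
  induction k, hk using Nat.le_induction with
  | base => norm_num
  | succ n hn ih =>
    have hn' : (2 : ℝ) ≤ n := by exact_mod_cast hn
    have := ih (by rw [← Real.exp_nat_mul]; ring_nf)
    rw [pow_succ (20 : ℝ)]
    push_cast
    nlinarith

theorem WeightedGraph.exists_communities_full {V : Type*} [Fintype V] [DecidableEq V]
    (G : WeightedGraph V) (hdeg : ∀ v, 0 < G.degree v) (k : ℕ) (hk1 : 1 ≤ k)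
    (hk : k ≤ Fintype.card V) :
    ∃ S S' : Fin k → Finset V, IsDisjointCommunities S S' ∧
      ∀ i : Fin k, G.bipartiteConductance (S i) (S' i) ≤
        2 * (8 * (k : ℝ) + 1) * (4 * (k : ℝ) - 1) / ((k : ℝ) + 1 - ((i : ℝ) + 1)) *
          √(G.avgTopGap k hk) := by
  have hk1' : (1 : ℝ) ≤ k := by exact_mod_cast hk1
  have hsqrt2 : √2 ≤ 1.415 := by
    rw [Real.sqrt_le_left (by norm_num)]; norm_num
  obtain ⟨m, hm, s, hs0, hs1, hr, hp, hbound⟩ : ∃ m : ℕ, 0 < m ∧ ∃ s : ℝ, 0 < s ∧ s ≤ 1 ∧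
      ((k : ℝ) - 1) / s + 3 / 4 < k ∧ (∀ c : ℝ, c ^ 2 < s →
        ((1 + c) / 2) ^ m + ((1 - c) / 2) ^ m ≤ 1 / (16 * (k : ℝ) ^ 2)) ∧
      1.415 * ((1 + 8 / 3 * √m) * k) ≤ (8 * k + 1) * (4 * k - 1) := by
    -- `k = 1` is separate because `32 k² ≤ exp (3k)` fails there.
    rcases hk1.eq_or_lt with rfl | hk2
    · refine ⟨16, by norm_num, 1 / 4, by norm_num, by norm_num, by norm_num, fun c hc => ?_, ?_⟩
      · have h := half_pow_add_half_pow_le (c := c) (d := 1 / 4) 16 (by norm_num)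
          (by norm_num at hc ⊢; linarith) (by norm_num)
        refine h.trans ?_
        have : (32 : ℝ) ≤ Real.exp 4 := by
          have e : Real.exp 4 = Real.exp 3 * Real.exp 1 := by rw [← Real.exp_add]; norm_num
          nlinarith [twenty_le_exp_three, Real.exp_one_gt_d9]
        norm_num
        rw [Real.exp_neg]
        have := inv_anti₀ (by norm_num) this
        linarith
      · have : √((16 : ℕ) : ℝ) = 4 := by
          rw [Real.sqrt_eq_iff_mul_self_eq] <;> norm_num
        rw [this]; norm_num
    · have hk2' : (2 : ℝ) ≤ k := by exact_mod_cast hk2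
      have hsmall : 1 / (4 * (k : ℝ)) ≤ 1 / 4 := by
        apply one_div_le_one_div_of_le <;> linarith
      have hpos : 0 < 1 / (4 * (k : ℝ)) := by positivity
      -- This `s` just suffices: `(k - 1) / s = k - 3k / (4k - 1) < k - 3/4`. It forces `d` of order
      -- `1/k`, so `m` of order `k²` for decay `exp (-3k)`; `49` makes `√m = 7k` exact.
      refine ⟨49 * k ^ 2, by positivity, 1 - 1 / (4 * k), by linarith, by linarith, ?_,
        fun c hc => ?_, ?_⟩
      · have e : 1 - 1 / (4 * (k : ℝ)) = (4 * k - 1) / (4 * k) := by field_simp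
        rw [e, div_div_eq_mul_div, div_add' _ _ _ (by linarith), div_lt_iff₀ (by linarith)]
        nlinarith
      · have e : 1 / (16 * (k : ℝ)) = 1 / (4 * k) / 4 := by field_simp; norm_num
        have h := half_pow_add_half_pow_le (c := c) (d := 1 / (16 * k)) (49 * k ^ 2)
          (by positivity) (by rw [e]; nlinarith) (by rw [e]; linarith)
        refine h.trans ?_
        have h1 : Real.exp (-((49 * k ^ 2 : ℕ) * (1 / (16 * (k : ℝ))))) ≤
            Real.exp (-(3 * k)) := by
          apply Real.exp_le_exp.2
          have : ((49 * k ^ 2 : ℕ) : ℝ) * (1 / (16 * (k : ℝ))) = 49 / 16 * k := by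
            push_cast; field_simp
          rw [this]; linarith
        have h2 : Real.exp (-(3 * k)) ≤ 1 / (32 * (k : ℝ) ^ 2) := by
          rw [Real.exp_neg, ← one_div]
          exact one_div_le_one_div_of_le (by positivity) (mul_sq_le_exp hk2)
        have h3 : 1 / (16 * (k : ℝ) ^ 2) = 2 * (1 / (32 * (k : ℝ) ^ 2)) := by field_simp; norm_num
        rw [h3]; linarith
      · have : √((49 * k ^ 2 : ℕ) : ℝ) = 7 * k := by
          rw [Real.sqrt_eq_iff_mul_self_eq (by positivity) (by positivity)]
          push_cast; ring
        rw [this]; nlinarith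
  obtain ⟨S, S', hSS, h⟩ := G.exists_isDisjointCommunities hdeg k hk1 hk hm hs0 hs1 hr hp
  refine ⟨S, S', hSS, fun i => (h i).trans ?_⟩
  have hi : (0 : ℝ) < k - i := by
    rw [sub_pos]; exact_mod_cast i.2
  rw [add_sub_add_right_eq_sub, div_mul_eq_mul_div _ _ √(G.avgTopGap k hk),
    Real.sqrt_mul zero_le_two]
  refine div_le_div_of_nonneg_right ?_ hi.le
  calc _ = 2 * (√2 * ((1 + 8 / 3 * √m) * k)) * √(G.avgTopGap k hk) := by ring
    _ ≤ 2 * ((8 * k + 1) * (4 * k - 1)) * √(G.avgTopGap k hk) := by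
        refine mul_le_mul_of_nonneg_right (mul_le_mul_of_nonneg_left ?_ zero_le_two)
          (Real.sqrt_nonneg _)
        exact (mul_le_mul_of_nonneg_right hsqrt2 (by positivity)).trans hbound
    _ = _ := by ring

theorem WeightedGraph.exists_communities_half {V : Type*} [Fintype V] [DecidableEq V]
    (G : WeightedGraph V) (hdeg : ∀ v, 0 < G.degree v) (k : ℕ) (hk1 : 1 ≤ k)
    (hk : k ≤ Fintype.card V) (r : ℕ) (hr : (r : ℝ) ≤ k / 2) :
    ∃ S S' : Fin r → Finset V, IsDisjointCommunities S S' ∧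
      ∀ i : Fin r, G.bipartiteConductance (S i) (S' i) ≤
        (10 : ℝ) ^ (1.5 : ℝ) * (1280 * √(3 * Real.log (200 * (k : ℝ) ^ 2)) + 4) * (k : ℝ) /
          (9 * ((k : ℝ) / 2 + 1 - ((i : ℝ) + 1))) * √(G.avgTopGap k hk) := by
  have hk1' : (1 : ℝ) ≤ k := by exact_mod_cast hk1
  have hsqrt2 : √2 ≤ 1.415 := by
    rw [Real.sqrt_le_left (by norm_num)]; norm_num
  have hrk : r ≤ k / 2 := by
    rw [Nat.le_div_iff_mul_le two_pos]
    have : (r : ℝ) * 2 ≤ k := by linarith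
    exact_mod_cast this
  set X := Real.log (200 * (k : ℝ) ^ 2) with hX
  have hk200 : 200 ≤ 200 * (k : ℝ) ^ 2 := by nlinarith
  have hX1 : 1 ≤ X := by
    rw [hX, Real.le_log_iff_exp_le (by positivity)]
    linarith [Real.exp_one_lt_d9]
  set m := ⌈8 * X⌉₊ with hm
  have hmX : 8 * X ≤ m := Nat.le_ceil _
  have hmX' : (m : ℝ) < 8 * X + 1 := Nat.ceil_lt_add_one (by linarith)
  have hm0 : 0 < m := Nat.ceil_pos.2 (by linarith)
  have hfloor : 2 * ((k / 2 : ℕ) : ℝ) ≤ k := by exact_mod_cast Nat.mul_div_le k 2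
  have hfloor' : (k : ℝ) ≤ 2 * ((k / 2 : ℕ) : ℝ) + 1 := by
    have : k ≤ 2 * (k / 2) + 1 := by omega
    exact_mod_cast this
  -- With `s = 1/2` a constant `d` works and `m` is only logarithmic in `k`. The full `⌊k/2⌋`
  -- communities are built, and the first `r` of them kept.
  obtain ⟨S, S', hSS, h⟩ := G.exists_isDisjointCommunities (r := k / 2) (s := 1 / 2)
    hdeg k hk1 hk hm0 (by norm_num) (by norm_num)
    (by rw [div_div_eq_mul_div, div_one]; linarith) (fun c hc => by
      have h := half_pow_add_half_pow_le (c := c) (d := 1 / 8) m (by norm_num)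
        (by norm_num at hc ⊢; linarith) (by norm_num)
      refine h.trans ?_
      have h1 : Real.exp (-(m * (1 / 8))) ≤ Real.exp (-X) := Real.exp_le_exp.2 (by linarith)
      rw [Real.exp_neg X, hX, Real.exp_log (by positivity)] at h1
      have h2 : (200 * (k : ℝ) ^ 2)⁻¹ ≤ (32 * (k : ℝ) ^ 2)⁻¹ :=
        inv_anti₀ (by positivity) (by nlinarith)
      have h3 : 1 / (16 * (k : ℝ) ^ 2) = 2 * (32 * (k : ℝ) ^ 2)⁻¹ := by field_simp; norm_num
      rw [h3]; linarith)
  have hmY : √m ≤ 3 * √(3 * X) := by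
    rw [Real.sqrt_le_left (by positivity), mul_pow, Real.sq_sqrt (by positivity)]
    linarith
  have hY1 : 1 ≤ √(3 * X) := Real.one_le_sqrt.2 (by linarith)
  have h10 : (9 : ℝ) ≤ (10 : ℝ) ^ (1.5 : ℝ) := by
    calc (9 : ℝ) ≤ (10 : ℝ) ^ (1 : ℝ) := by norm_num
      _ ≤ _ := Real.rpow_le_rpow_of_exponent_le (by norm_num) (by norm_num)
  set T := (10 : ℝ) ^ (1.5 : ℝ) with hT
  refine ⟨fun i => S (Fin.castLE hrk i), fun i => S' (Fin.castLE hrk i),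
    ⟨fun i => hSS.nonempty _, fun i => hSS.disjoint_pair _, fun i j hij =>
      hSS.disjoint_of_ne _ _ ((Fin.castLE_injective hrk).ne hij)⟩,
    fun i => (h (Fin.castLE hrk i)).trans ?_⟩
  have hi : (1 : ℝ) ≤ ((k / 2 : ℕ) : ℝ) - i := by
    have : (i : ℕ) + 1 ≤ k / 2 := i.2.trans_le hrk
    have : (i : ℝ) + 1 ≤ ((k / 2 : ℕ) : ℝ) := by exact_mod_cast this
    linarith
  rw [add_sub_add_right_eq_sub, div_mul_eq_mul_div _ _ √(G.avgTopGap k hk),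
    Real.sqrt_mul zero_le_two, Fin.val_castLE,
    div_le_div_iff₀ (by linarith) (by linarith)]
  set Y := √(3 * X)
  set D := ((k / 2 : ℕ) : ℝ) - i
  -- The factor `3/2` replaces `k/2` by its floor: they differ by at most `1/2`, and `D ≥ 1`.
  calc 2 * (1 + 8 / 3 * √m) * k * (√2 * √(G.avgTopGap k hk)) * (9 * (k / 2 - i))
      ≤ 2 * (1 + 8 / 3 * (3 * Y)) * k * (1.415 * √(G.avgTopGap k hk)) * (9 * (3 / 2 * D)) := by
        gcongr
        · have : (i : ℝ) + 1 ≤ ((k / 2 : ℕ) : ℝ) := by linarith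
          linarith
        · linarith
    _ = 9 * (2 * (1 + 8 * Y) * 1.415 * (3 / 2)) * k * √(G.avgTopGap k hk) * D := by ring
    _ ≤ T * (1280 * Y + 4) * k * √(G.avgTopGap k hk) * D := by
        gcongr
        linarith

/-- The index `i : Fin r` is 0-based: it stands for the index `i + 1` of `1, …, r`. -/
theorem theorem3 {V : Type*} [Fintype V] [DecidableEq V] (G : WeightedGraph V)
    (hdeg : ∀ v, 0 < G.degree v) (k : ℕ) (hk1 : 1 ≤ k) (hk : k ≤ Fintype.card V) :
    (∃ S S' : Fin k → Finset V, IsDisjointCommunities S S' ∧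
      ∀ i : Fin k, G.bipartiteConductance (S i) (S' i) ≤
        2 * (8 * (k : ℝ) + 1) * (4 * (k : ℝ) - 1) / ((k : ℝ) + 1 - ((i : ℝ) + 1)) *
          √(G.avgTopGap k hk)) ∧
    (∀ r : ℕ, (r : ℝ) ≤ (k : ℝ) / 2 →
      ∃ S S' : Fin r → Finset V, IsDisjointCommunities S S' ∧
        ∀ i : Fin r, G.bipartiteConductance (S i) (S' i) ≤
          (10 : ℝ) ^ (1.5 : ℝ) * (1280 * √(3 * Real.log (200 * (k : ℝ) ^ 2)) + 4) * (k : ℝ) /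
              (9 * ((k : ℝ) / 2 + 1 - ((i : ℝ) + 1))) *
            √(G.avgTopGap k hk)) :=
  ⟨G.exists_communities_full hdeg k hk1 hk,
    fun r hr => G.exists_communities_half hdeg k hk1 hk r hr⟩
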